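/- Let $\mathbb D$ be the open unit disc, $\log^+x=\max(\log x,0)$ (with $\log^+0=0$), and let $\Lambda=(\lambda_i)_{i\in I}$ be a finite or infinite sequence of points of $\mathbb D$. The Nevanlinna class $N$ consists of the holomorphic functions $f$ on $\mathbb D$ with $$\lim_{r\to1^-}\frac1{2\pi}\int_0^{2\pi}\log^+|f(re^{i\theta})|\,d\theta<\infty ,$$ and the Smirnov class $N^+$ consists of those $f\in N$ for which this limit equals $\frac1{2\pi}\int_0^{2\pi}\log^+|f(e^{i\theta})|\,d\theta$, where $f(e^{i\theta})=\lim_{r\to1^-}f(re^{i\theta})$ denotes the boundary values of $f$, which exist for almost every $\theta$. For a class $X$ of functions on $\mathbb D$ let $X|\Lambda=\{(f(\lambda_i))_{i\in I}: f\in X\}$, and let $$l_{\mathrm{Ya}}=\Bigl\{(a_i)_{i\in I}\in\mathbb C^I:\ \sum_{i}(1-|\lambda_i|)\log^+|a_i|<\infty\Bigr\}.$$ Let $P_z(\zeta)=\frac{1-|z|^2}{|\zeta-z|^2}$ be the Poisson kernel ($z\in\mathbb D$, $|\zeta|=1$), and let $\mu_\Lambda=\sum_i(1-|\lambda_i|)\,\delta_{\lambda_i}$.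 The Poisson balayage of a positive measure $\mu$ on $\mathbb D$ is $B(\mu)(\zeta)=\int_{\mathbb D}P_z(\zeta)\,d\mu(z)$, $|\zeta|=1$. Then the following are equivalent: (a) $N|\Lambda\subset l_{\mathrm{Ya}}$; (b) $N^+|\Lambda\subset l_{\mathrm{Ya}}$; (c) $\mu_\Lambda$ has bounded balayage, i.e. $\displaystyle\sup_{|\zeta|=1}B(\mu_\Lambda)(\zeta)=\sup_{|\zeta|=1}\sum_i(1-|\lambda_i|)P_{\lambda_i}(\zeta)<\infty$. -/

import Mathlib

open Filter Topology MeasureTheory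
open scoped ENNReal NNReal

noncomputable section

namespace Nevanlinna

/-- The Nevanlinna class `N`: functions holomorphic in the open unit disc whose circular means
`(1/2π) ∫₀^{2π} log⁺ |f(r e^{iθ})| dθ` have a finite limit as `r → 1⁻`. (These means are
nondecreasing in `r`, so the limit always exists in `[0, ∞]`.)
Elements are represented by total functions `ℂ → ℂ`; only the values in the disc matter. -/
def nevanlinnaClass : Set (ℂ → ℂ) :=
  {f | DifferentiableOn ℂ f (Metric.ball 0 1) ∧
    ∃ L : ℝ, Tendsto (fun r : ℝ => Real.circleAverage (fun z => Real.posLog ‖f z‖) 0 r)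
      (𝓝[<] 1) (𝓝 L)}

/-- `g` is a boundary function of `f`: for almost every `θ`, the radial limit of `f` at `e^{iθ}`
exists and is equal to `g (e^{iθ})`. -/
def IsBoundaryFunction (f g : ℂ → ℂ) : Prop :=
  ∀ᵐ θ : ℝ, Tendsto (fun r : ℝ => f (circleMap 0 r θ)) (𝓝[<] 1) (𝓝 (g (circleMap 0 1 θ)))

/-- The Smirnov class `N⁺`: functions `f ∈ N` such that the limit as `r → 1⁻` of the circular
means of `log⁺ |f|` is the mean of `log⁺ |f|` over the unit circle, where `f (e^{iθ})` denotes
the boundary values of `f` (which exist a.e. for each `f ∈ N`). -/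
def smirnovClass : Set (ℂ → ℂ) :=
  {f | f ∈ nevanlinnaClass ∧
    ∃ g : ℂ → ℂ, IsBoundaryFunction f g ∧
      CircleIntegrable (fun z => Real.posLog ‖g z‖) 0 1 ∧
      Tendsto (fun r : ℝ => Real.circleAverage (fun z => Real.posLog ‖f z‖) 0 r)
        (𝓝[<] 1) (𝓝 (Real.circleAverage (fun z => Real.posLog ‖g z‖) 0 1))}

/-- The trace `X|Λ`: all sequences `(f (Λ i))_i` with `f ∈ X`. -/
def trace {ι : Type*} (X : Set (ℂ → ℂ)) (Λ : ι → ℂ) : Set (ι → ℂ) :=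
  {a | ∃ f ∈ X, ∀ i, a i = f (Λ i)}

/-- Yanagihara's space `l_Ya`: all sequences `a` with `∑ (1 - |Λ i|) log⁺ |a i| < ∞`. -/
def yanagiharaSpace {ι : Type*} (Λ : ι → ℂ) : Set (ι → ℂ) :=
  {a | Summable fun i => (1 - ‖Λ i‖) * Real.posLog ‖a i‖}

/-- The measure `μ_Λ = ∑ (1 - |Λ i|) δ_{Λ i}`. -/
def sequenceMeasure {ι : Type*} (Λ : ι → ℂ) : Measure ℂ :=
  Measure.sum fun i => ENNReal.ofReal (1 - ‖Λ i‖) • Measure.dirac (Λ i)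

/-- The Poisson balayage `B(μ)(ζ) = ∫_𝔻 P_z(ζ) dμ(z)` for `|ζ| = 1`, where
`P_z(ζ) = poissonKernel 0 z ζ = (1 - |z|²) / |ζ - z|²`. -/
def balayage (μ : Measure ℂ) (ζ : ℂ) : ℝ≥0∞ :=
  ∫⁻ z in Metric.ball 0 1, ENNReal.ofReal (poissonKernel 0 z ζ) ∂μ

/-- `μ` has bounded balayage: `sup_{|ζ| = 1} B(μ)(ζ) < ∞`. -/
def HasBoundedBalayage (μ : Measure ℂ) : Prop :=
  ∃ C : ℝ≥0, ∀ ζ ∈ Metric.sphere (0 : ℂ) 1, balayage μ ζ ≤ C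

end Nevanlinna

end

/-!
Let `S_F(ζ)` be the sum of `(1 - |Λ i|) P_{Λ i}(ζ)` over a finite set `F` of indices; bounded balayage
means that all these sums are bounded on the unit circle by one constant `C`.

*Bounded balayage suffices for `N`.* For `f` holomorphic near the closed disc, `log⁺ |f|` is
dominated by its Poisson integral (`posLog_norm_le_circleAverage`), so the sum of
`(1 - |Λ i|) log⁺ |f (Λ i)|` over `F` is at most the mean of `S_F log⁺ |f|`, hence at most `C` times the
mean of `log⁺ |f|` on the circle. For `f ∈ N` this is applied to the dilations `z ↦ f (r z)`, and
`r → 1` bounds all partial sums (`trace_nevanlinnaClass_subset`).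

*It is necessary for `N⁺`.* If the sums are unbounded, compactness yields points `ζₙ → ζ₀` of the
circle with some `S_F(ζₙ) > 4ⁿ`. Moving `ζₙ` slightly into the disc to `aₙ`, consider
`G = ∑ 2⁻ⁿ (1 + āₙz) / (1 - āₙz)`, whose real part is the Poisson integral of `∑ 2⁻ⁿ P_{aₙ}`. As all `aₙ`
cluster only at `ζ₀`, radial limits of `G` exist at every other point of the circle, and no general
theorem on boundary values is required. The means of `log⁺ |exp G| = Re G` equal `∑ 2⁻ⁿ` on every
circle of radius at most `1`, so `exp G ∈ N⁺` (`exp_herglotzSeries_mem_smirnovClass`). The `n`-th term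
of `G` alone contributes at least `2ⁿ` to `∑ (1 - |Λ i|) log⁺ |exp G (Λ i)|`, which therefore diverges
(`exists_bound_of_trace_smirnovClass_subset`).
-/

namespace Nevanlinna

open Metric Complex ComplexConjugate

/-! ### Poisson majorants of `log⁺ |f|` -/

/-- Powers `ζⁿ` with `n ≥ 0` go into `p`, those with `n < 0` into `q`, since `ζ⁻¹` is the conjugate
of `ζ` on the unit circle. -/
theorem exists_re_add_conj_of_mem_span_fourier {L : C(AddCircle (1 : ℝ), ℂ)}
    (hL : L ∈ Submodule.span ℂ (Set.range (@fourier 1))) :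
    ∃ p q : ℂ → ℂ, Differentiable ℂ p ∧ Differentiable ℂ q ∧
      ∀ x, L x = p (AddCircle.toCircle x) + conj (q (AddCircle.toCircle x)) := by
  induction hL using Submodule.span_induction with
  | mem L h =>
    obtain ⟨n, rfl⟩ := h
    obtain ⟨m, rfl | rfl⟩ := n.eq_nat_or_neg
    · refine ⟨fun z => z ^ m, 0, by fun_prop, differentiable_const 0, fun x => ?_⟩
      simp [fourier_apply, AddCircle.toCircle_nsmul]
    · refine ⟨0, fun z => z ^ m, differentiable_const 0, by fun_prop, fun x => ?_⟩
      rw [fourier_neg]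
      simp [fourier_apply, AddCircle.toCircle_nsmul]
  | zero => exact ⟨0, 0, differentiable_const 0, differentiable_const 0, by simp⟩
  | add L M _ _ hL hM =>
    obtain ⟨p, q, hp, hq, h⟩ := hL
    obtain ⟨p', q', hp', hq', h'⟩ := hM
    refine ⟨p + p', q + q', hp.add hp', hq.add hq', fun x => ?_⟩
    simp [h, h']
    ring
  | smul c L _ hL =>
    obtain ⟨p, q, hp, hq, h⟩ := hL
    refine ⟨c • p, conj c • q, hp.const_smul c, hq.const_smul _, fun x => ?_⟩
    simp [h]
    ring

/-- Trigonometric polynomials are uniformly dense, and the real part of `p + conj q` is that of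
`p + q`. This replaces the solution of the Dirichlet problem with boundary data `h`. -/
theorem exists_differentiable_re_close {h : ℂ → ℝ} (hh : ContinuousOn h (sphere 0 1))
    {ε : ℝ} (hε : 0 < ε) :
    ∃ p : ℂ → ℂ, Differentiable ℂ p ∧ ∀ ζ ∈ sphere (0 : ℂ) 1, |h ζ - (p ζ).re| < ε := by
  have hc : Continuous fun x : AddCircle (1 : ℝ) => ((h (AddCircle.toCircle x) : ℝ) : ℂ) := by
    refine continuous_ofReal.comp (hh.comp_continuous ?_ fun x => ?_)
    · exact continuous_subtype_val.comp AddCircle.continuous_toCircle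
    · rw [mem_sphere_zero_iff_norm, Circle.norm_coe]
  have hmem : (⟨_, hc⟩ : C(AddCircle (1 : ℝ), ℂ)) ∈
      closure (Submodule.span ℂ (Set.range (@fourier 1)) : Set C(AddCircle (1 : ℝ), ℂ)) := by
    rw [← Submodule.topologicalClosure_coe, span_fourier_closure_eq_top]
    trivial
  obtain ⟨L, hL, hd⟩ := Metric.mem_closure_iff.1 hmem ε hε
  obtain ⟨p, q, hp, hq, h'⟩ := exists_re_add_conj_of_mem_span_fourier hL
  refine ⟨p + q, hp.add hq, fun ζ hζ => ?_⟩
  have hx : (AddCircle.toCircle ((arg ζ / (2 * Real.pi) : ℝ) : AddCircle (1 : ℝ)) : ℂ) = ζ := by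
    rw [AddCircle.toCircle_apply_mk, Circle.coe_exp]
    conv_rhs => rw [← norm_mul_exp_arg_mul_I ζ, mem_sphere_zero_iff_norm.1 hζ]
    have : (2 * Real.pi / 1 * (arg ζ / (2 * Real.pi)) : ℝ) = arg ζ := by
      field_simp
    rw [this]; simp
  have := (ContinuousMap.dist_lt_iff hε).1 hd ((arg ζ / (2 * Real.pi) : ℝ) : AddCircle (1 : ℝ))
  rw [dist_eq_norm, h'] at this
  simp only [ContinuousMap.coe_mk, hx] at this
  refine lt_of_le_of_lt ?_ this
  refine le_trans (le_of_eq ?_) (abs_re_le_norm _)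
  simp

theorem continuousOn_poissonKernel_sphere {w : ℂ} (hw : w ∈ ball (0 : ℂ) 1) :
    ContinuousOn (poissonKernel 0 w) (sphere (0 : ℂ) 1) := by
  rw [poissonKernel_eq_re_herglotzRieszKernel]
  have := continuousOn_herglotzRieszKernel_sphere hw
  rw [abs_one] at this
  exact continuous_re.comp_continuousOn this

theorem circleAverage_poissonKernel_mul_re {p : ℂ → ℂ} (hp : DiffContOnCl ℂ p (ball 0 1)) {w : ℂ}
    (hw : w ∈ ball (0 : ℂ) 1) :
    Real.circleAverage (fun ζ => poissonKernel 0 w ζ * (p ζ).re) 0 1 = (p w).re := by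
  have hK := continuousOn_poissonKernel_sphere hw
  have hp' : ContinuousOn p (sphere 0 1) := hp.continuousOn_ball.mono sphere_subset_closedBall
  rw [← hp.circleAverage_poissonKernel_smul hw, ← reCLM_apply,
    ← reCLM.circleAverage_comp_comm ((hK.smul hp').circleIntegrable zero_le_one)]
  congr 1
  ext ζ
  simp

theorem poissonKernel_nonneg {w ζ : ℂ} (hw : w ∈ ball (0 : ℂ) 1) (hζ : ζ ∈ sphere (0 : ℂ) 1) :
    0 ≤ poissonKernel 0 w ζ := by
  rw [mem_ball_zero_iff] at hw
  rw [mem_sphere_zero_iff_norm] at hζ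
  rw [poissonKernel_def]
  refine div_nonneg ?_ (by positivity)
  simp only [sub_zero, hζ]
  nlinarith [norm_nonneg w]

theorem circleAverage_poissonKernel {w : ℂ} (hw : w ∈ ball (0 : ℂ) 1) :
    Real.circleAverage (poissonKernel 0 w) 0 1 = 1 := by
  have := circleAverage_poissonKernel_mul_re (p := fun _ => 1) diffContOnCl_const hw
  simpa using this

/-- `log⁺ |f|` lies below its Poisson integral. Instead of the harmonic majorant itself, use
`Re p` with `p` entire and `log⁺ |f| ≤ Re p ≤ log⁺ |f| + ε` on the circle: the maximum principle for
`f * exp (-p)` and `exp (-p)` gives `log⁺ |f w| ≤ Re (p w)`. -/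
theorem posLog_norm_le_circleAverage {f : ℂ → ℂ} (hf : DiffContOnCl ℂ f (ball 0 1)) {w : ℂ}
    (hw : w ∈ ball (0 : ℂ) 1) :
    Real.posLog ‖f w‖ ≤
      Real.circleAverage (fun ζ => poissonKernel 0 w ζ * Real.posLog ‖f ζ‖) 0 1 := by
  have hfc : ContinuousOn f (sphere 0 1) := hf.continuousOn_ball.mono sphere_subset_closedBall
  have hh : ContinuousOn (fun ζ => Real.posLog ‖f ζ‖) (sphere (0 : ℂ) 1) :=
    Real.continuous_posLog.comp_continuousOn hfc.norm
  have hK := continuousOn_poissonKernel_sphere hw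
  refine le_of_forall_pos_le_add fun ε hε => ?_
  obtain ⟨p₀, hp₀, hclose⟩ := exists_differentiable_re_close hh (half_pos hε)
  set p : ℂ → ℂ := fun z => p₀ z + (ε / 2 : ℝ)
  have hp : Differentiable ℂ p := hp₀.add_const _
  have hlow : ∀ ζ ∈ sphere (0 : ℂ) 1, Real.posLog ‖f ζ‖ ≤ (p ζ).re := fun ζ hζ => by
    have := (abs_lt.1 (hclose ζ hζ)).2
    simp only [p, add_re, ofReal_re]; linarith
  have hupp : ∀ ζ ∈ sphere (0 : ℂ) 1, (p ζ).re ≤ Real.posLog ‖f ζ‖ + ε := fun ζ hζ => by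
    have := (abs_lt.1 (hclose ζ hζ)).1
    simp only [p, add_re, ofReal_re]; linarith
  have hwcl : w ∈ closure (ball (0 : ℂ) 1) := subset_closure hw
  -- The maximum principle, applied to `g = f` and to `g = 1`.
  have key : ∀ g : ℂ → ℂ, DiffContOnCl ℂ g (ball 0 1) →
      (∀ ζ ∈ sphere (0 : ℂ) 1, ‖g ζ‖ ≤ Real.exp (Real.posLog ‖f ζ‖)) →
      ‖g w‖ ≤ Real.exp (p w).re := by
    intro g hg hgle
    have hd : DiffContOnCl ℂ (fun z => exp (-p z) * g z) (ball 0 1) :=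
      DiffContOnCl.smul (f := g) hp.neg.cexp.diffContOnCl hg
    have := norm_le_of_forall_mem_frontier_norm_le isBounded_ball hd (C := 1) (fun ζ hζ => ?_) hwcl
    · rw [norm_mul, norm_exp, neg_re, Real.exp_neg, inv_mul_le_iff₀ (Real.exp_pos _), mul_one]
        at this
      exact this
    · rw [frontier_ball _ one_ne_zero] at hζ
      rw [norm_mul, norm_exp, neg_re, Real.exp_neg, inv_mul_le_iff₀ (Real.exp_pos _), mul_one]
      exact (hgle ζ hζ).trans (Real.exp_le_exp.2 (hlow ζ hζ))
  have h1 : ‖f w‖ ≤ Real.exp (p w).re := key f hf fun ζ _ => by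
    rcases eq_or_ne ‖f ζ‖ 0 with h0 | h0
    · rw [h0]; exact (Real.exp_pos _).le
    · calc ‖f ζ‖ = Real.exp (Real.log ‖f ζ‖) := (Real.exp_log (by positivity)).symm
        _ ≤ _ := Real.exp_le_exp.2 (le_max_right _ _)
  have h2 : ‖(1 : ℂ)‖ ≤ Real.exp (p w).re := key (fun _ => 1) diffContOnCl_const fun ζ _ => by
    simpa using Real.posLog_nonneg
  have h3 : Real.posLog ‖f w‖ ≤ (p w).re := by
    have h0 : 0 ≤ (p w).re := by simpa using h2
    refine (Real.posLog_le_posLog (norm_nonneg _) h1).trans (le_of_eq ?_)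
    rw [Real.posLog, Real.log_exp, max_eq_right h0]
  refine h3.trans ?_
  rw [← circleAverage_poissonKernel_mul_re hp.diffContOnCl hw]
  have hKi : CircleIntegrable (poissonKernel 0 w) 0 1 := hK.circleIntegrable zero_le_one
  have hi : CircleIntegrable (fun ζ => poissonKernel 0 w ζ * Real.posLog ‖f ζ‖) 0 1 :=
    (hK.mul hh).circleIntegrable zero_le_one
  calc _ ≤ Real.circleAverage
        (fun ζ => poissonKernel 0 w ζ * Real.posLog ‖f ζ‖ + ε • poissonKernel 0 w ζ) 0 1 := by
        refine Real.circleAverage_mono ?_ (hi.add hKi.const_smul) fun ζ hζ => ?_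
        · exact (hK.mul (continuous_re.comp_continuousOn
            hp.continuous.continuousOn)).circleIntegrable zero_le_one
        · rw [abs_one] at hζ
          have := mul_le_mul_of_nonneg_left (hupp ζ hζ) (poissonKernel_nonneg hw hζ)
          rw [smul_eq_mul]; linarith
    _ = _ := by
        rw [Real.circleAverage_fun_add hi (CircleIntegrable.const_fun_smul hKi),
          Real.circleAverage_fun_smul, circleAverage_poissonKernel hw, smul_eq_mul, mul_one]

theorem sum_mul_posLog_norm_le {ι : Type*} {F : Finset ι} {c : ι → ℝ} {w : ι → ℂ} {f : ℂ → ℂ}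
    {C : ℝ} (hf : DiffContOnCl ℂ f (ball 0 1)) (hw : ∀ i ∈ F, w i ∈ ball (0 : ℂ) 1)
    (hc : ∀ i ∈ F, 0 ≤ c i)
    (hC : ∀ ζ ∈ sphere (0 : ℂ) 1, ∑ i ∈ F, c i * poissonKernel 0 (w i) ζ ≤ C) :
    ∑ i ∈ F, c i * Real.posLog ‖f (w i)‖ ≤
      C * Real.circleAverage (fun ζ => Real.posLog ‖f ζ‖) 0 1 := by
  have hh : ContinuousOn (fun ζ => Real.posLog ‖f ζ‖) (sphere (0 : ℂ) 1) :=
    Real.continuous_posLog.comp_continuousOn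
      (hf.continuousOn_ball.mono sphere_subset_closedBall).norm
  have hi : ∀ i ∈ F, CircleIntegrable
      (fun ζ => c i • (poissonKernel 0 (w i) ζ * Real.posLog ‖f ζ‖)) 0 1 := fun i hi =>
    (((continuousOn_poissonKernel_sphere (hw i hi)).mul hh).const_smul (c i)).circleIntegrable
      zero_le_one
  calc ∑ i ∈ F, c i * Real.posLog ‖f (w i)‖
      ≤ ∑ i ∈ F, c i *
          Real.circleAverage (fun ζ => poissonKernel 0 (w i) ζ * Real.posLog ‖f ζ‖) 0 1 :=
        Finset.sum_le_sum fun i hi =>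
          mul_le_mul_of_nonneg_left (posLog_norm_le_circleAverage hf (hw i hi)) (hc i hi)
    _ = Real.circleAverage
          (fun ζ => ∑ i ∈ F, c i • (poissonKernel 0 (w i) ζ * Real.posLog ‖f ζ‖)) 0 1 := by
        rw [Real.circleAverage_fun_sum hi]
        refine Finset.sum_congr rfl fun i _ => ?_
        rw [Real.circleAverage_fun_smul, smul_eq_mul]
    _ ≤ Real.circleAverage (fun ζ => C • Real.posLog ‖f ζ‖) 0 1 := by
        refine Real.circleAverage_mono (CircleIntegrable.fun_sum F hi)
          ((hh.const_smul C).circleIntegrable zero_le_one) fun ζ hζ => ?_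
        rw [abs_one] at hζ
        simp only [smul_eq_mul, ← mul_assoc]
        rw [← Finset.sum_mul]
        exact mul_le_mul_of_nonneg_right (hC ζ hζ) Real.posLog_nonneg
    _ = _ := by rw [Real.circleAverage_fun_smul, smul_eq_mul]

theorem trace_nevanlinnaClass_subset {ι : Type*} {Λ : ι → ℂ}
    (hΛ : ∀ i, Λ i ∈ ball (0 : ℂ) 1) {C : ℝ}
    (hC : ∀ F : Finset ι, ∀ ζ ∈ sphere (0 : ℂ) 1,
      ∑ i ∈ F, (1 - ‖Λ i‖) * poissonKernel 0 (Λ i) ζ ≤ C) :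
    trace nevanlinnaClass Λ ⊆ yanagiharaSpace Λ := by
  rintro a ⟨f, ⟨hf, L, hL⟩, ha⟩
  have hpos : ∀ i, 0 ≤ 1 - ‖Λ i‖ := fun i => by
    have := mem_ball_zero_iff.1 (hΛ i); linarith
  simp only [yanagiharaSpace, Set.mem_ofPred_eq, ha]
  refine summable_of_sum_le (c := C * L) (fun i => mul_nonneg (hpos i) Real.posLog_nonneg)
    fun F => ?_
  have hlim : Tendsto (fun r : ℝ => ∑ i ∈ F, (1 - ‖Λ i‖) * Real.posLog ‖f (r * Λ i)‖) (𝓝[<] 1)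
      (𝓝 (∑ i ∈ F, (1 - ‖Λ i‖) * Real.posLog ‖f (Λ i)‖)) := by
    refine tendsto_finsetSum _ fun i _ => Tendsto.const_mul _ ?_
    refine (Real.continuous_posLog.tendsto _).comp (Tendsto.norm ?_)
    have hd : Tendsto f (𝓝 (Λ i)) (𝓝 (f (Λ i))) :=
      (hf.differentiableAt (isOpen_ball.mem_nhds (hΛ i))).continuousAt
    refine hd.comp ?_
    have : Tendsto (fun r : ℝ => (r : ℂ) * Λ i) (𝓝 1) (𝓝 (((1 : ℝ) : ℂ) * Λ i)) :=
      (continuous_ofReal.mul continuous_const).tendsto 1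
    rw [ofReal_one, one_mul] at this
    exact this.mono_left nhdsWithin_le_nhds
  -- The bound holds for each dilation `z ↦ f (r z)`, which is holomorphic near the closed disc.
  refine le_of_tendsto_of_tendsto hlim (hL.const_mul C) ?_
  have hIoo : Set.Ioo (0 : ℝ) 1 ∈ 𝓝[<] (1 : ℝ) := Ioo_mem_nhdsLT one_pos
  filter_upwards [hIoo] with r hr
  rw [Real.circleAverage_eq_circleAverage_zero_one]
  simp only [add_zero]
  refine sum_mul_posLog_norm_le (f := fun z => f (r * z)) (w := Λ) ?_ (fun i _ => hΛ i)
    (fun i _ => hpos i) (hC F)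
  apply DifferentiableOn.diffContOnCl
  rw [closure_ball _ one_ne_zero]
  refine hf.comp (by fun_prop) fun z hz => ?_
  rw [mem_closedBall_zero_iff] at hz
  rw [mem_ball_zero_iff, norm_mul, norm_real, Real.norm_of_nonneg hr.1.le]
  nlinarith [hr.1, hr.2]

/-! ### Exponentials of Herglotz series in the Smirnov class -/

/-- The Herglotz function `(1 + āz) / (1 - āz)` of `z`. For `|a| < 1` its real part is the Poisson
integral of the Poisson kernel of `a`; for `|a| = 1` it is the Herglotz–Riesz kernel. -/
noncomputable def herglotz (a z : ℂ) : ℂ := (1 + conj a * z) / (1 - conj a * z)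

theorem herglotz_zero (a : ℂ) : herglotz a 0 = 1 := by simp [herglotz]

theorem norm_herglotz_le {a z : ℂ} (ha : ‖a‖ ≤ 1) (hz : ‖z‖ ≤ 1) :
    ‖herglotz a z‖ ≤ 2 * ‖1 - conj a * z‖⁻¹ := by
  rw [herglotz, norm_div, div_eq_mul_inv]
  refine mul_le_mul_of_nonneg_right ?_ (by positivity)
  refine (norm_add_le _ _).trans ?_
  rw [norm_one, norm_mul, RCLike.norm_conj]
  nlinarith [norm_nonneg a, norm_nonneg z]

theorem one_sub_le_norm_one_sub_conj_mul {a z : ℂ} (ha : ‖a‖ ≤ 1) :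
    1 - ‖z‖ ≤ ‖1 - conj a * z‖ := by
  have := norm_sub_norm_le (1 : ℂ) (conj a * z)
  rw [norm_one, norm_mul, RCLike.norm_conj] at this
  nlinarith [norm_nonneg z]

theorem one_sub_conj_mul_ne_zero {a z : ℂ} (h : ‖a‖ * ‖z‖ < 1) : 1 - conj a * z ≠ 0 := by
  intro h0
  have : ‖conj a * z‖ = 1 := by rw [← sub_eq_zero.1 h0, norm_one]
  rw [norm_mul, RCLike.norm_conj] at this
  exact h.ne this

theorem herglotz_re_nonneg {a z : ℂ} (ha : ‖a‖ ≤ 1) (hz : ‖z‖ ≤ 1) : 0 ≤ (herglotz a z).re := by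
  have h : ‖conj a * z‖ ≤ 1 := by
    rw [norm_mul, RCLike.norm_conj]
    exact mul_le_one₀ ha (norm_nonneg _) hz
  have h2 : normSq (conj a * z) ≤ 1 := by
    rw [normSq_eq_norm_sq]; nlinarith [norm_nonneg (conj a * z)]
  rw [herglotz, div_re, ← add_div]
  refine div_nonneg ?_ (normSq_nonneg _)
  rw [normSq_apply] at h2
  simp only [add_re, sub_re, add_im, sub_im, one_re, one_im]
  nlinarith

theorem differentiableAt_herglotz {a z : ℂ} (h : ‖a‖ * ‖z‖ < 1) :
    DifferentiableAt ℂ (herglotz a) z := by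
  unfold herglotz
  have := one_sub_conj_mul_ne_zero h
  fun_prop (disch := assumption)

theorem herglotz_of_norm_eq_one {ζ z : ℂ} (hζ : ‖ζ‖ = 1) :
    (herglotz ζ z).re = poissonKernel 0 z ζ := by
  have h1 : conj ζ * ζ = 1 := by
    rw [mul_comm, mul_conj, normSq_eq_norm_sq, hζ]; simp
  have h0 : ζ ≠ 0 := by rintro rfl; simp at hζ
  rw [poissonKernel_eq_re_herglotzRieszKernel, Function.comp_apply, herglotzRieszKernel_def,
    herglotz, ← mul_div_mul_right _ _ h0]
  congr 2
  · linear_combination z * h1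
  · linear_combination -z * h1

theorem circleAverage_herglotz_re {a : ℂ} (ha : ‖a‖ < 1) :
    Real.circleAverage (fun z => (herglotz a z).re) 0 1 = 1 := by
  have hd : DiffContOnCl ℂ (herglotz a) (ball 0 |1|) := by
    refine DifferentiableOn.diffContOnCl fun z hz => ?_
    rw [abs_one, closure_ball _ one_ne_zero, mem_closedBall_zero_iff] at hz
    exact (differentiableAt_herglotz (by nlinarith [norm_nonneg a])).differentiableWithinAt
  have hi : CircleIntegrable (herglotz a) 0 1 := by
    rw [abs_one] at hd
    exact (hd.continuousOn_ball.mono sphere_subset_closedBall).circleIntegrable zero_le_one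
  have := reCLM.circleAverage_comp_comm hi
  rw [hd.circleAverage, herglotz_zero] at this
  simpa [Function.comp_def] using this

/-- The series `∑ cₙ (1 + āₙz) / (1 - āₙz)`. With `∑ cₙ < ∞` and `aₙ → ζ₀` it converges at every point
of the closed disc other than `ζ₀`, where the `tsum` may be the junk value `0`. -/
noncomputable def herglotzSeries (c : ℕ → ℝ) (a : ℕ → ℂ) (z : ℂ) : ℂ :=
  ∑' n, c n * herglotz (a n) z

section
variable {c : ℕ → ℝ} {a : ℕ → ℂ} {ζ₀ : ℂ}

theorem norm_mul_herglotz_le (hc0 : ∀ n, 0 < c n) (ha : ∀ n, ‖a n‖ < 1) {z : ℂ} (hz : ‖z‖ ≤ 1)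
    {M : ℝ} {n : ℕ} (hM : ‖1 - conj (a n) * z‖⁻¹ ≤ M) :
    ‖(c n : ℂ) * herglotz (a n) z‖ ≤ c n * (2 * M) := by
  rw [norm_mul, norm_real, Real.norm_of_nonneg (hc0 n).le]
  refine mul_le_mul_of_nonneg_left ((norm_herglotz_le (ha n).le hz).trans ?_) (hc0 n).le
  linarith

theorem norm_mul_herglotz_le_of_norm_le (hc0 : ∀ n, 0 < c n) (ha : ∀ n, ‖a n‖ < 1) {z : ℂ}
    {ρ : ℝ} (hρ : ρ < 1) (hz : ‖z‖ ≤ ρ) (n : ℕ) :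
    ‖(c n : ℂ) * herglotz (a n) z‖ ≤ c n * (2 * (1 - ρ)⁻¹) := by
  refine norm_mul_herglotz_le hc0 ha (hz.trans hρ.le) ?_
  refine inv_anti₀ (by linarith) ?_
  have := one_sub_le_norm_one_sub_conj_mul (z := z) (ha n).le
  linarith

theorem differentiableOn_herglotzSeries (hc : Summable c) (hc0 : ∀ n, 0 < c n)
    (ha : ∀ n, ‖a n‖ < 1) : DifferentiableOn ℂ (herglotzSeries c a) (ball 0 1) := by
  intro z hz
  rw [mem_ball_zero_iff] at hz
  obtain ⟨ρ, hzρ, hρ⟩ := exists_between hz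
  have := differentiableOn_tsum_of_summable_norm (U := ball (0 : ℂ) ρ)
    (F := fun n z => (c n : ℂ) * herglotz (a n) z)
    (u := fun n => c n * (2 * (1 - ρ)⁻¹)) (hc.mul_right _) (fun n w hw => ?_) isOpen_ball
    fun n w hw => norm_mul_herglotz_le_of_norm_le hc0 ha hρ (mem_ball_zero_iff.1 hw).le n
  · exact (this.differentiableAt (isOpen_ball.mem_nhds
      (mem_ball_zero_iff.2 hzρ))).differentiableWithinAt
  · rw [mem_ball_zero_iff] at hw
    exact ((differentiableAt_herglotz (by
      nlinarith [norm_nonneg (a n), norm_nonneg w, ha n])).const_mul _).differentiableWithinAt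

theorem summable_herglotzSeries (hc : Summable c) (hc0 : ∀ n, 0 < c n) (ha : ∀ n, ‖a n‖ < 1)
    {z : ℂ} (hz : ‖z‖ < 1) : Summable fun n => (c n : ℂ) * herglotz (a n) z :=
  Summable.of_norm_bounded (hc.mul_right _)
    fun n => norm_mul_herglotz_le_of_norm_le hc0 ha hz le_rfl n

theorem exists_inv_norm_le (haζ : Tendsto a atTop (𝓝 ζ₀)) (hζ₀ : ‖ζ₀‖ = 1) {ζ : ℂ}
    (hζ : ζ ≠ ζ₀) : ∃ M, ∀ n, ‖1 - conj (a n) * ζ‖⁻¹ ≤ M := by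
  have h0 : 1 - conj ζ₀ * ζ ≠ 0 := by
    intro h
    apply hζ
    have h1 : ζ₀ * conj ζ₀ = 1 := by rw [mul_conj, normSq_eq_norm_sq, hζ₀]; simp
    linear_combination -ζ * h1 - ζ₀ * h
  have ht : Tendsto (fun n => ‖1 - conj (a n) * ζ‖⁻¹) atTop (𝓝 ‖1 - conj ζ₀ * ζ‖⁻¹) := by
    refine Tendsto.inv₀ ?_ (norm_ne_zero_iff.2 h0)
    exact (((continuous_conj.tendsto _).comp haζ).mul_const ζ |>.const_sub 1).norm
  obtain ⟨M, hM⟩ := ht.bddAbove_range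
  exact ⟨M, fun n => hM ⟨n, rfl⟩⟩

/-- Along a radius, the distance to `1` drops by at most a factor of two; this makes bounds on the
circle uniform along radii. -/
theorem norm_one_sub_mul_le {w : ℂ} (hw : ‖w‖ ≤ 1) {r : ℝ} (hr0 : 0 ≤ r) (hr1 : r ≤ 1) :
    ‖1 - w‖ ≤ 2 * ‖1 - r * w‖ := by
  have h1 : ‖1 - w‖ ≤ ‖1 - r * w‖ + (1 - r) * ‖w‖ := by
    have : 1 - w = (1 - r * w) - ((1 - r : ℝ) : ℂ) * w := by push_cast; ring
    rw [this]
    refine (norm_sub_le _ _).trans (le_of_eq ?_)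
    rw [norm_mul ((1 - r : ℝ) : ℂ), norm_real, Real.norm_of_nonneg (by linarith)]
  have h2 := norm_sub_norm_le (1 : ℂ) (r * w)
  rw [norm_one, norm_mul, norm_real, Real.norm_of_nonneg hr0] at h2
  nlinarith [norm_nonneg w]

theorem tendsto_herglotzSeries_radial (hc : Summable c) (hc0 : ∀ n, 0 < c n)
    (ha : ∀ n, ‖a n‖ < 1) (haζ : Tendsto a atTop (𝓝 ζ₀)) (hζ₀ : ‖ζ₀‖ = 1) {ζ : ℂ} (hζ1 : ‖ζ‖ = 1)
    (hζ : ζ ≠ ζ₀) :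
    Tendsto (fun r : ℝ => herglotzSeries c a (r * ζ)) (𝓝[<] 1) (𝓝 (herglotzSeries c a ζ)) := by
  obtain ⟨M, hM⟩ := exists_inv_norm_le haζ hζ₀ hζ
  refine tendsto_tsum_of_dominated_convergence (bound := fun n => c n * (2 * (2 * M)))
    (hc.mul_right _) (fun n => Tendsto.const_mul _ ?_) ?_
  · have hd : Tendsto (herglotz (a n)) (𝓝 ζ) (𝓝 (herglotz (a n) ζ)) :=
      (differentiableAt_herglotz (by rw [hζ1, mul_one]; exact ha n)).continuousAt
    refine hd.comp (Tendsto.mono_left ?_ nhdsWithin_le_nhds)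
    have : Tendsto (fun r : ℝ => (r : ℂ) * ζ) (𝓝 1) (𝓝 (((1 : ℝ) : ℂ) * ζ)) :=
      (continuous_ofReal.mul continuous_const).tendsto 1
    rwa [ofReal_one, one_mul] at this
  · have hIoo : Set.Ioo (0 : ℝ) 1 ∈ 𝓝[<] (1 : ℝ) := Ioo_mem_nhdsLT one_pos
    filter_upwards [hIoo] with r hr n
    have hz : ‖(r : ℂ) * ζ‖ ≤ 1 := by
      rw [norm_mul, hζ1, mul_one, norm_real, Real.norm_of_nonneg hr.1.le]; exact hr.2.le
    refine norm_mul_herglotz_le hc0 ha hz ?_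
    have hw : ‖conj (a n) * ζ‖ < 1 := by rw [norm_mul, RCLike.norm_conj, hζ1, mul_one]; exact ha n
    have hpos : 0 < ‖1 - conj (a n) * ζ‖ := by
      rw [norm_pos_iff]
      exact one_sub_conj_mul_ne_zero (by rw [hζ1, mul_one]; exact ha n)
    have h2 := norm_one_sub_mul_le hw.le hr.1.le hr.2.le
    rw [show conj (a n) * (r * ζ) = r * (conj (a n) * ζ) by ring]
    calc ‖1 - r * (conj (a n) * ζ)‖⁻¹ ≤ (‖1 - conj (a n) * ζ‖ / 2)⁻¹ :=
          inv_anti₀ (by positivity) (by linarith)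
      _ = 2 * ‖1 - conj (a n) * ζ‖⁻¹ := by rw [inv_div, div_eq_mul_inv]
      _ ≤ 2 * M := by linarith [hM n]

theorem herglotzSeries_zero : herglotzSeries c a 0 = ((∑' n, c n : ℝ) : ℂ) := by
  simp [herglotzSeries, herglotz_zero, ofReal_tsum]

theorem hasSum_re_herglotzSeries {z : ℂ}
    (h : Summable fun n => (c n : ℂ) * herglotz (a n) z) :
    HasSum (fun n => c n * (herglotz (a n) z).re) (herglotzSeries c a z).re := by
  have := hasSum_re h.hasSum
  simpa [herglotzSeries] using this

theorem herglotzSeries_re_nonneg (hc0 : ∀ n, 0 < c n) (ha : ∀ n, ‖a n‖ < 1) {z : ℂ}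
    (hz : ‖z‖ ≤ 1) : 0 ≤ (herglotzSeries c a z).re := by
  by_cases h : Summable fun n => (c n : ℂ) * herglotz (a n) z
  · exact (hasSum_re_herglotzSeries h).nonneg
      fun n => mul_nonneg (hc0 n).le (herglotz_re_nonneg (ha n).le hz)
  · rw [herglotzSeries, tsum_eq_zero_of_not_summable h, zero_re]

theorem posLog_norm_exp_herglotzSeries (hc0 : ∀ n, 0 < c n) (ha : ∀ n, ‖a n‖ < 1) {z : ℂ}
    (hz : ‖z‖ ≤ 1) : Real.posLog ‖exp (herglotzSeries c a z)‖ = (herglotzSeries c a z).re := by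
  rw [norm_exp, Real.posLog, Real.log_exp, max_eq_right (herglotzSeries_re_nonneg hc0 ha hz)]

/-- The mean value property: the means of `log⁺ |exp G| = Re G` do not depend on the radius. -/
theorem circleAverage_posLog_exp_herglotzSeries (hc : Summable c) (hc0 : ∀ n, 0 < c n)
    (ha : ∀ n, ‖a n‖ < 1) {r : ℝ} (hr : r ∈ Set.Ioo (0 : ℝ) 1) :
    Real.circleAverage (fun z => Real.posLog ‖exp (herglotzSeries c a z)‖) 0 r = ∑' n, c n := by
  have hsub : closedBall (0 : ℂ) |r| ⊆ ball 0 1 := by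
    rw [abs_of_pos hr.1]; exact closedBall_subset_ball hr.2
  have hd : DiffContOnCl ℂ (herglotzSeries c a) (ball 0 |r|) := by
    apply DifferentiableOn.diffContOnCl
    rw [closure_ball _ (abs_pos.2 hr.1.ne').ne']
    exact (differentiableOn_herglotzSeries hc hc0 ha).mono hsub
  have hi : CircleIntegrable (herglotzSeries c a) 0 r :=
    (hd.continuousOn_ball.mono sphere_subset_closedBall).circleIntegrable'
  have h1 := reCLM.circleAverage_comp_comm hi
  rw [hd.circleAverage, herglotzSeries_zero, reCLM_apply, ofReal_re] at h1
  rw [← h1]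
  refine Real.circleAverage_congr_sphere fun z hz => ?_
  have := mem_ball_zero_iff.1 (hsub (sphere_subset_closedBall hz))
  simp [posLog_norm_exp_herglotzSeries hc0 ha this.le]

theorem ae_hasSum_re_herglotzSeries (hc : Summable c) (hc0 : ∀ n, 0 < c n)
    (ha : ∀ n, ‖a n‖ < 1) (haζ : Tendsto a atTop (𝓝 ζ₀)) (hζ₀ : ‖ζ₀‖ = 1) :
    ∀ᵐ θ : ℝ, HasSum (fun n => c n * (herglotz (a n) (circleMap 0 1 θ)).re)
      (herglotzSeries c a (circleMap 0 1 θ)).re := by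
  have hae : ∀ᵐ θ : ℝ, circleMap 0 1 θ ≠ ζ₀ :=
    compl_mem_ae_iff.2
      (((Set.countable_singleton ζ₀).preimage_circleMap 0 one_ne_zero).measure_zero _)
  filter_upwards [hae] with θ hθ
  obtain ⟨M, hM⟩ := exists_inv_norm_le haζ hζ₀ hθ
  exact hasSum_re_herglotzSeries (Summable.of_norm_bounded (hc.mul_right _)
    fun n => norm_mul_herglotz_le hc0 ha (by simp) (hM n))

/-- Integration term by term on the unit circle, so that no mass escapes to the boundary. -/
theorem circleAverage_herglotzSeries_re (hc : Summable c) (hc0 : ∀ n, 0 < c n)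
    (ha : ∀ n, ‖a n‖ < 1) (haζ : Tendsto a atTop (𝓝 ζ₀)) (hζ₀ : ‖ζ₀‖ = 1) :
    CircleIntegrable (fun z => (herglotzSeries c a z).re) 0 1 ∧
      Real.circleAverage (fun z => (herglotzSeries c a z).re) 0 1 = ∑' n, c n := by
  have h2pi : (0 : ℝ) ≤ 2 * Real.pi := Real.two_pi_pos.le
  have hcont : ∀ n, Continuous fun θ : ℝ => c n * (herglotz (a n) (circleMap 0 1 θ)).re := by
    intro n
    refine continuous_const.mul (continuous_re.comp ?_)
    refine continuous_iff_continuousAt.2 fun θ => ?_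
    exact ContinuousAt.comp (differentiableAt_herglotz (by simpa using ha n)).continuousAt
      (continuous_circleMap 0 1).continuousAt
  have hint : ∀ n, ∫ θ in Set.Ioc 0 (2 * Real.pi), c n * (herglotz (a n) (circleMap 0 1 θ)).re =
      c n * (2 * Real.pi) := by
    intro n
    have h := circleAverage_herglotz_re (ha n)
    rw [Real.circleAverage_def, smul_eq_mul, inv_mul_eq_iff_eq_mul₀ Real.two_pi_pos.ne',
      mul_one] at h
    rw [integral_const_mul, ← intervalIntegral.integral_of_le h2pi, h]
  have hnonneg : ∀ n (θ : ℝ), 0 ≤ c n * (herglotz (a n) (circleMap 0 1 θ)).re := fun n θ =>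
    mul_nonneg (hc0 n).le (herglotz_re_nonneg (ha n).le (by simp))
  have hsum := hasSum_integral_of_summable_integral_norm
    (μ := volume.restrict (Set.Ioc 0 (2 * Real.pi)))
    (F := fun n (θ : ℝ) => c n * (herglotz (a n) (circleMap 0 1 θ)).re)
    (fun n => (hcont n).integrableOn_Ioc) (by
      simp only [Real.norm_of_nonneg (hnonneg _ _), hint]
      exact hc.mul_right _)
  simp only [hint] at hsum
  have hval : ∫ θ in Set.Ioc 0 (2 * Real.pi), (herglotzSeries c a (circleMap 0 1 θ)).re =
      (∑' n, c n) * (2 * Real.pi) := by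
    rw [← (hc.hasSum.mul_right (2 * Real.pi)).unique hsum |>.symm]
    refine integral_congr_ae ?_
    filter_upwards [ae_restrict_of_ae (ae_hasSum_re_herglotzSeries hc hc0 ha haζ hζ₀)] with θ hθ
    exact hθ.tsum_eq.symm
  have hpos : 0 < ∑' n, c n := hc.tsum_pos (fun n => (hc0 n).le) 0 (hc0 0)
  constructor
  -- The integral has a nonzero value, so it is not the junk value of a divergent integral.
  · rw [CircleIntegrable, intervalIntegrable_iff_integrableOn_Ioc_of_le h2pi]
    refine Integrable.of_integral_ne_zero ?_
    rw [hval]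
    have := Real.two_pi_pos
    positivity
  · rw [Real.circleAverage_def, intervalIntegral.integral_of_le h2pi, hval, smul_eq_mul]
    field_simp

theorem exp_herglotzSeries_mem_smirnovClass (hc : Summable c) (hc0 : ∀ n, 0 < c n)
    (ha : ∀ n, ‖a n‖ < 1) (haζ : Tendsto a atTop (𝓝 ζ₀)) (hζ₀ : ‖ζ₀‖ = 1) :
    (fun z => exp (herglotzSeries c a z)) ∈ smirnovClass := by
  have hlim : Tendsto (fun r : ℝ => Real.circleAverage
      (fun z => Real.posLog ‖exp (herglotzSeries c a z)‖) 0 r) (𝓝[<] 1) (𝓝 (∑' n, c n)) := by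
    refine tendsto_const_nhds.congr' ?_
    have hIoo : Set.Ioo (0 : ℝ) 1 ∈ 𝓝[<] (1 : ℝ) := Ioo_mem_nhdsLT one_pos
    filter_upwards [hIoo] with r hr
    exact (circleAverage_posLog_exp_herglotzSeries hc hc0 ha hr).symm
  have hEq : Set.EqOn (fun z => Real.posLog ‖exp (herglotzSeries c a z)‖)
      (fun z => (herglotzSeries c a z).re) (sphere 0 |1|) := fun z hz => by
    rw [abs_one, mem_sphere_zero_iff_norm] at hz
    exact posLog_norm_exp_herglotzSeries hc0 ha hz.le
  obtain ⟨hint, hav⟩ := circleAverage_herglotzSeries_re hc hc0 ha haζ hζ₀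
  refine ⟨⟨(differentiableOn_herglotzSeries hc hc0 ha).cexp, _, hlim⟩,
    fun z => exp (herglotzSeries c a z), ?_, ?_, ?_⟩
  · have hae : ∀ᵐ θ : ℝ, circleMap 0 1 θ ≠ ζ₀ :=
      compl_mem_ae_iff.2
        (((Set.countable_singleton ζ₀).preimage_circleMap 0 one_ne_zero).measure_zero _)
    filter_upwards [hae] with θ hθ
    have := tendsto_herglotzSeries_radial hc hc0 ha haζ hζ₀ (by simp) hθ
    have h := (continuous_exp.tendsto _).comp this
    refine h.congr fun r => ?_
    simp [circleMap]
  · refine (circleIntegrable_congr fun z hz => ?_).2 hint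
    exact hEq hz
  · rw [Real.circleAverage_congr_sphere hEq, hav]
    exact hlim

end

/-! ### Necessity of bounded balayage -/

theorem exists_near_lt_sum_herglotz_re {ι : Type*} {Λ : ι → ℂ}
    (hΛ : ∀ i, Λ i ∈ ball (0 : ℂ) 1) {F : Finset ι} {ζ : ℂ} (hζ : ‖ζ‖ = 1) {K : ℝ}
    (hK : K < ∑ i ∈ F, (1 - ‖Λ i‖) * poissonKernel 0 (Λ i) ζ) {δ : ℝ} (hδ : 0 < δ) :
    ∃ a : ℂ, ‖a‖ < 1 ∧ dist a ζ < δ ∧ K < ∑ i ∈ F, (1 - ‖Λ i‖) * (herglotz a (Λ i)).re := by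
  have hcont : Tendsto (fun a => ∑ i ∈ F, (1 - ‖Λ i‖) * (herglotz a (Λ i)).re) (𝓝 ζ)
      (𝓝 (∑ i ∈ F, (1 - ‖Λ i‖) * poissonKernel 0 (Λ i) ζ)) := by
    refine tendsto_finsetSum _ fun i _ => Tendsto.const_mul _ ?_
    rw [← herglotz_of_norm_eq_one hζ]
    refine (continuous_re.tendsto _).comp ?_
    have hne : 1 - conj ζ * Λ i ≠ 0 :=
      one_sub_conj_mul_ne_zero (by rw [hζ, one_mul]; exact mem_ball_zero_iff.1 (hΛ i))
    have h : ContinuousAt (fun a => conj a * Λ i) ζ :=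
      (continuous_conj.mul continuous_const).continuousAt
    exact (h.const_add 1).div (h.const_sub 1) hne
  have hev := (hcont.eventually (lt_mem_nhds hK)).and (ball_mem_nhds ζ hδ)
  have hcl : ζ ∈ closure (ball (0 : ℂ) 1) := by
    rw [closure_ball _ one_ne_zero, mem_closedBall_zero_iff, hζ]
  obtain ⟨a, ⟨h1, h2⟩, h3⟩ := mem_closure_iff_nhds.1 hcl _ hev
  exact ⟨a, mem_ball_zero_iff.1 h3, h2, h1⟩

/-- If the sums are unbounded on the circle, take `ζₙ → ζ₀` with a finite sum above `4ⁿ` at `ζₙ`, replace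
`ζₙ` by a nearby point `aₙ` of the disc, and test with `exp (∑ 2⁻ⁿ (1 + āₙz) / (1 - āₙz)) ∈ N⁺`. -/
theorem exists_bound_of_trace_smirnovClass_subset {ι : Type*} {Λ : ι → ℂ}
    (hΛ : ∀ i, Λ i ∈ ball (0 : ℂ) 1) (h : trace smirnovClass Λ ⊆ yanagiharaSpace Λ) :
    ∃ C : ℝ, ∀ F : Finset ι, ∀ ζ ∈ sphere (0 : ℂ) 1,
      ∑ i ∈ F, (1 - ‖Λ i‖) * poissonKernel 0 (Λ i) ζ ≤ C := by
  by_contra! hcon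
  choose F ζ hζ hlt using fun n : ℕ => hcon (4 ^ n)
  obtain ⟨ζ₀, hζ₀, φ, hφ, hlim⟩ := (isCompact_sphere (0 : ℂ) 1).tendsto_subseq hζ
  rw [mem_sphere_zero_iff_norm] at hζ₀
  choose a ha hdist hsum using fun n : ℕ => exists_near_lt_sum_herglotz_re hΛ
    (mem_sphere_zero_iff_norm.1 (hζ (φ n))) (hlt (φ n)) (Nat.one_div_pos_of_nat (α := ℝ) (n := n))
  have haζ : Tendsto a atTop (𝓝 ζ₀) := by
    rw [tendsto_iff_dist_tendsto_zero]
    have hz := (tendsto_one_div_add_atTop_nhds_zero_nat (𝕜 := ℝ)).add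
      (tendsto_iff_dist_tendsto_zero.1 hlim)
    rw [add_zero] at hz
    refine squeeze_zero (fun _ => dist_nonneg) (fun n => ?_) hz
    exact (dist_triangle _ (ζ (φ n)) _).trans (add_le_add (hdist n).le le_rfl)
  set c : ℕ → ℝ := fun n => (1 / 2) ^ n
  have hc : Summable c := summable_geometric_two
  have hc0 : ∀ n, 0 < c n := fun n => by positivity
  have hmem : (fun i => exp (herglotzSeries c a (Λ i))) ∈ yanagiharaSpace Λ :=
    h ⟨_, exp_herglotzSeries_mem_smirnovClass hc hc0 ha haζ hζ₀, fun _ => rfl⟩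
  simp only [yanagiharaSpace, Set.mem_ofPred_eq] at hmem
  have hΛ' : ∀ i, ‖Λ i‖ < 1 := fun i => mem_ball_zero_iff.1 (hΛ i)
  have hbound : ∀ n : ℕ, (2 : ℝ) ^ n ≤
      ∑' i, (1 - ‖Λ i‖) * Real.posLog ‖exp (herglotzSeries c a (Λ i))‖ := fun n => by
    calc (2 : ℝ) ^ n = c n * 4 ^ n := by simp only [c, ← mul_pow]; norm_num
      _ ≤ c n * 4 ^ φ n := mul_le_mul_of_nonneg_left
          (pow_le_pow_right₀ (by norm_num) (hφ.id_le n)) (hc0 n).le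
      _ ≤ c n * ∑ i ∈ F (φ n), (1 - ‖Λ i‖) * (herglotz (a n) (Λ i)).re :=
          mul_le_mul_of_nonneg_left (hsum n).le (hc0 n).le
      _ = ∑ i ∈ F (φ n), (1 - ‖Λ i‖) * (c n * (herglotz (a n) (Λ i)).re) := by
          rw [Finset.mul_sum]
          exact Finset.sum_congr rfl fun i _ => by ring
      _ ≤ ∑ i ∈ F (φ n), (1 - ‖Λ i‖) * Real.posLog ‖exp (herglotzSeries c a (Λ i))‖ := by
          refine Finset.sum_le_sum fun i _ => mul_le_mul_of_nonneg_left ?_ (by linarith [hΛ' i])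
          rw [posLog_norm_exp_herglotzSeries hc0 ha (hΛ' i).le]
          exact le_hasSum (hasSum_re_herglotzSeries (summable_herglotzSeries hc hc0 ha (hΛ' i))) n
            fun m _ => mul_nonneg (hc0 m).le (herglotz_re_nonneg (ha m).le (hΛ' i).le)
      _ ≤ _ := hmem.sum_le_tsum _
          fun i _ => mul_nonneg (by linarith [hΛ' i]) Real.posLog_nonneg
  obtain ⟨n, hn⟩ := pow_unbounded_of_one_lt
    (∑' i, (1 - ‖Λ i‖) * Real.posLog ‖exp (herglotzSeries c a (Λ i))‖) (one_lt_two (α := ℝ))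
  exact (hbound n).not_gt hn

/-! ### Balayage as a sum -/

theorem balayage_sequenceMeasure {ι : Type*} {Λ : ι → ℂ} (hΛ : ∀ i, Λ i ∈ ball (0 : ℂ) 1)
    (ζ : ℂ) : balayage (sequenceMeasure Λ) ζ =
      ∑' i, ENNReal.ofReal ((1 - ‖Λ i‖) * poissonKernel 0 (Λ i) ζ) := by
  classical
  rw [balayage, sequenceMeasure, Measure.restrict_sum _ measurableSet_ball, lintegral_sum_measure]
  refine tsum_congr fun i => ?_
  rw [Measure.restrict_smul, lintegral_smul_measure, restrict_dirac, if_pos (hΛ i),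
    lintegral_dirac, smul_eq_mul, ENNReal.ofReal_mul]
  have := mem_ball_zero_iff.1 (hΛ i)
  linarith

theorem forall_sum_le_iff_tsum_ofReal_le {ι : Type*} {Λ : ι → ℂ}
    (hΛ : ∀ i, Λ i ∈ ball (0 : ℂ) 1) (C : ℝ≥0) {ζ : ℂ} (hζ : ζ ∈ sphere (0 : ℂ) 1) :
    (∀ F : Finset ι, ∑ i ∈ F, (1 - ‖Λ i‖) * poissonKernel 0 (Λ i) ζ ≤ C) ↔
      ∑' i, ENNReal.ofReal ((1 - ‖Λ i‖) * poissonKernel 0 (Λ i) ζ) ≤ C := by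
  rw [ENNReal.tsum_eq_iSup_sum, iSup_le_iff]
  refine forall_congr' fun F => ?_
  rw [← ENNReal.ofReal_sum_of_nonneg, ENNReal.ofReal_le_iff_le_toReal ENNReal.coe_ne_top,
    ENNReal.coe_toReal]
  intro i _
  have := mem_ball_zero_iff.1 (hΛ i)
  exact mul_nonneg (by linarith) (poissonKernel_nonneg (hΛ i) hζ)

end Nevanlinna

theorem proposition1p12 {ι : Type*} [Countable ι] (Λ : ι → ℂ)
    (hΛ : ∀ i, Λ i ∈ Metric.ball (0 : ℂ) 1) :
    List.TFAE [
      Nevanlinna.trace Nevanlinna.nevanlinnaClass Λ ⊆ Nevanlinna.yanagiharaSpace Λ,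
      Nevanlinna.trace Nevanlinna.smirnovClass Λ ⊆ Nevanlinna.yanagiharaSpace Λ,
      Nevanlinna.HasBoundedBalayage (Nevanlinna.sequenceMeasure Λ),
      ∃ C : ℝ≥0, ∀ ζ ∈ Metric.sphere (0 : ℂ) 1,
        ∑' i, ENNReal.ofReal ((1 - ‖Λ i‖) * poissonKernel 0 (Λ i) ζ) ≤ C] := by
  tfae_have 1 → 2 := fun h a ⟨f, hf, ha⟩ => h ⟨f, hf.1, ha⟩
  tfae_have 3 ↔ 4 := by
    simp only [Nevanlinna.HasBoundedBalayage, Nevanlinna.balayage_sequenceMeasure hΛ]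
  tfae_have 4 → 1 := fun ⟨C, hC⟩ =>
    Nevanlinna.trace_nevanlinnaClass_subset hΛ fun F ζ hζ =>
      (Nevanlinna.forall_sum_le_iff_tsum_ofReal_le hΛ C hζ).2 (hC ζ hζ) F
  tfae_have 2 → 4 := fun h => by
    obtain ⟨C, hC⟩ := Nevanlinna.exists_bound_of_trace_smirnovClass_subset hΛ h
    exact ⟨C.toNNReal, fun ζ hζ => (Nevanlinna.forall_sum_le_iff_tsum_ofReal_le hΛ _ hζ).1
      fun F => (hC F ζ hζ).trans (Real.le_coe_toNNReal C)⟩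
  tfae_finish
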